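/- Fix $p\in[0,1]$ and consider the memoryless state-dependent broadcast channel with binary input $x$, binary state $S$ and binary outputs $Y,Z$, where the states are IID with $\Pr[S=1]=\Pr[S=0]=\tfrac12$, where $Y=x\oplus S$, and where $Z$ is the output of a binary symmetric channel with input $x$ and crossover probability $p$ that is unaffected by the state: $\Pr[Z=x\mid X=x,S=s]=1-p$ and $\Pr[Z=x\oplus 1\mid X=x,S=s]=p$. The transmitter sends two independent, uniformly distributed private messages, $M_y\in\{1,\dots,\lfloor 2^{nR_y}\rfloor\}$ to the receiver observing $Y^n$ and $M_z\in\{1,\dots,\lfloor 2^{nR_z}\rfloor\}$ to the receiver observing $Z^n$. The state is known causally to the transmitter, that is, the $i$-th input is a function of $(M_y,M_z,S_1,\dots,S_i)$, and is unknown to the receivers. A pair of rates $R_y,R_z\ge 0$ (in bits per channel use) is achievable if for every $\varepsilon>0$ and all sufficiently large $n$ there is a code of blocklength $n$ for which the probability that at least one of the receivers decodes its message incorrectly is at most $\varepsilon$. The capacity region is the closure of the set of achievable rate pairs. Let $H_b(p)=-p\log_2 p-(1-p)\log_2(1-p)$ (with $0\log_2 0=0$). Then the capacity region is $$\bigcup_{\lambda\in[0,1]}\bigl\{(R_y,R_z):\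 0\le R_y\le\lambda,\ \ 0\le R_z\le(1-\lambda)\bigl(1-H_b(p)\bigr)\bigr\}.$$ If $p\neq\tfrac12$, it is therefore the set of all $(R_y,R_z)$ with $R_y,R_z\ge 0$ and $$R_y+\frac{R_z}{1-H_b(p)}\le 1.$$ -/

import Mathlib

open scoped BigOperators

/-- A discrete memoryless state-dependent semideterministic broadcast channel, with input alphabet
`X`, state alphabet `S` and output alphabets `Y`, `Z`: the states are drawn IID from `stateLaw`;
given input `x` and state `s`, the first receiver observes `f x s` with probability one and the
second one observes `z` with probability `W x s z`. -/
structure SemidetChannel (X S Y Z : Type) [Fintype S] [Fintype Z] where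
  stateLaw : S → ℝ
  stateLaw_nonneg : ∀ s, 0 ≤ stateLaw s
  stateLaw_sum : ∑ s, stateLaw s = 1
  f : X → S → Y
  W : X → S → Z → ℝ
  W_nonneg : ∀ x s z, 0 ≤ W x s z
  W_sum : ∀ x s, ∑ z, W x s z = 1

/-- A code of blocklength `n` for two private messages, `my ∈ Fin My` and `mz ∈ Fin Mz`, with
causal state-information at the encoder (the `i`-th input depends on the message pair and on the
states up to and including time `i` only) and no state-information at the decoders. -/
structure CausalCode (X S Y Z : Type) (n My Mz : ℕ) where
  encode : Fin My → Fin Mz → (Fin n → S) → Fin n → X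
  causal : ∀ my mz (i : Fin n) (s s' : Fin n → S),
    (∀ j, j ≤ i → s j = s' j) → encode my mz s i = encode my mz s' i
  decodeY : (Fin n → Y) → Fin My
  decodeZ : (Fin n → Z) → Fin Mz

/-- The probability, over independent and uniformly distributed messages, the IID states and the
channel noise, that at least one of the two receivers decodes its message incorrectly. -/
noncomputable def SemidetChannel.errorProb {X S Y Z : Type} [Fintype S] [Fintype Z]
    (ch : SemidetChannel X S Y Z) {n My Mz : ℕ} (c : CausalCode X S Y Z n My Mz) : ℝ :=
  (∑ my : Fin My, ∑ mz : Fin Mz, ∑ s : Fin n → S, ∑ z : Fin n → Z,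
    (∏ i, ch.stateLaw (s i)) * (∏ i, ch.W (c.encode my mz s i) (s i) (z i)) *
      (if c.decodeY (fun i => ch.f (c.encode my mz s i) (s i)) = my ∧ c.decodeZ z = mz
        then 0 else 1)) / ((My : ℝ) * (Mz : ℝ))

/-- A pair of nonnegative rates `(R_y, R_z)`, in bits per channel use, is achievable with causal
state-information if for every `ε > 0` and all large enough blocklengths `n` some causal code with
`⌊2 ^ (n R_y)⌋` and `⌊2 ^ (n R_z)⌋` messages has error probability at most `ε`. -/
def SemidetChannel.CausallyAchievable {X S Y Z : Type} [Fintype S] [Fintype Z]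
    (ch : SemidetChannel X S Y Z) (R : ℝ × ℝ) : Prop :=
  0 ≤ R.1 ∧ 0 ≤ R.2 ∧ ∀ ε : ℝ, 0 < ε → ∃ N : ℕ, ∀ n : ℕ, N ≤ n →
    ∃ c : CausalCode X S Y Z n ⌊(2 : ℝ) ^ ((n : ℝ) * R.1)⌋₊ ⌊(2 : ℝ) ^ ((n : ℝ) * R.2)⌋₊,
      ch.errorProb c ≤ ε

/-- The capacity region with causal state-information at the transmitter only. -/
def SemidetChannel.causalCapacityRegion {X S Y Z : Type} [Fintype S] [Fintype Z]
    (ch : SemidetChannel X S Y Z) : Set (ℝ × ℝ) :=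
  closure {R | ch.CausallyAchievable R}

/-- The binary channel with `P_S(1) = σ`, `Y = x ⊕ S`, and `Z` the output of a binary symmetric
channel with crossover probability `p` and input `x`, unaffected by the state. -/
def binaryChannel (σ p : ℝ) (hσ : σ ∈ Set.Icc (0 : ℝ) 1) (hp : p ∈ Set.Icc (0 : ℝ) 1) :
    SemidetChannel Bool Bool Bool Bool where
  stateLaw s := if s = true then σ else 1 - σ
  stateLaw_nonneg s := by
    rcases hσ with ⟨h0, h1⟩
    cases s <;> simp [h0, h1]
  stateLaw_sum := by simp
  f x s := xor x s
  W x _ z := if z = x then 1 - p else p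
  W_nonneg x _ z := by
    rcases hp with ⟨h0, h1⟩
    cases x <;> cases z <;> simp [h0, h1]
  W_sum x _ := by cases x <;> simp

/-- The binary entropy function in bits. -/
noncomputable def binEntropyBits (p : ℝ) : ℝ := Real.binEntropy p / Real.log 2

/-! Given the messages and the past states, a causal encoder picks at each time a map from the
present state to the input. If the map is constant, `Y = x ⊕ S` is uniform and carries nothing,
while `Z` sees a binary symmetric channel. If it is not constant, the input is uniform, so `Z`
carries nothing, while `Y` is a deterministic bit. Thus each channel use serves only one receiver,
and time-sharing is optimal.

For the converse, let `D` be the expected number of constant maps, averaged over both messages. Up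
to vanishing terms, `n R_y ≤ n - D` and `n R_z ≤ (1 - H_b(p)) D`, with the same `D`. The one-use
bounds `xorKernel_step` and `bscKernel_step` control the divergence of the output from the uniform
law in variational form; `expected_log_le` chains them over time, and `fano_bound` turns them into
rate bounds.

For the direct part, `Y` is served without error by cancelling the state, and `Z` by a code for the
binary symmetric channel, obtained from `feinstein` and a Chebyshev estimate of the typical set. -/

/-! ### Variational bound and Fano's inequality for causal encoders -/

/-- A sum over Boolean vectors splits off the first coordinate. -/
theorem sum_boolVec_succ {n : ℕ} (F : (Fin (n + 1) → Bool) → ℝ) :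
    ∑ v, F v = ∑ b, ∑ w : Fin n → Bool, F (Fin.cons b w) := by
  rw [← (Fin.consEquiv (fun _ : Fin (n + 1) => Bool)).sum_comp, Fintype.sum_prod_type]
  rfl

theorem sum_prod_eq_one {n : ℕ} (F : Fin n → Bool → ℝ) (hF : ∀ i, ∑ b, F i b = 1) :
    ∑ v : Fin n → Bool, ∏ i, F i (v i) = 1 := by
  rw [← Fintype.prod_sum]
  simp only [hF, Finset.prod_const_one]

/-- The indicator that a map from states to inputs ignores the state. -/
noncomputable def constIndicator (t : Bool → Bool) : ℝ := if t false = t true then 1 else 0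

/-- The expected number of times at which a causal encoder ignores the present state, for IID
uniform states. -/
noncomputable def expectedConst : (n : ℕ) → ((Fin n → Bool) → Fin n → Bool) → ℝ
  | 0, _ => 0
  | n + 1, e => constIndicator (fun b => e (Fin.cons b fun _ => false) 0) +
      ∑ b, (1 / 2) * expectedConst n (fun s i => e (Fin.cons b s) i.succ)

theorem expectedConst_nonneg : ∀ (n : ℕ) (e : (Fin n → Bool) → Fin n → Bool),
    0 ≤ expectedConst n e
  | 0, _ => le_rfl
  | n + 1, e => by
    rw [expectedConst]
    refine add_nonneg ?_ (Finset.sum_nonneg fun b _ =>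
      mul_nonneg (by norm_num) (expectedConst_nonneg n _))
    unfold constIndicator
    split_ifs <;> norm_num

/-- A variational bound on the expected logarithm of a function of the output, by induction on the
blocklength from the bound for a single channel use. -/
theorem expected_log_le (K : Bool → Bool → Bool → ℝ) (hK : ∀ x s o, 0 ≤ K x s o)
    (hK1 : ∀ x s, ∑ o, K x s o = 1) (α β : ℝ)
    (step : ∀ (t : Bool → Bool) (g : Bool → ℝ), (∀ o, 0 < g o) →
      ∑ s, 1 / 2 * ∑ o, K (t s) s o * Real.log (g o) ≤
        α + β * constIndicator t + Real.log ((∑ o, g o) / 2)) :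
    ∀ (n : ℕ) (e : (Fin n → Bool) → Fin n → Bool),
      (∀ (i : Fin n) (s s' : Fin n → Bool), (∀ j, j ≤ i → s j = s' j) → e s i = e s' i) →
      ∀ g : (Fin n → Bool) → ℝ, (∀ o, 0 < g o) →
      ∑ s : Fin n → Bool, (1 / 2) ^ n * ∑ o : Fin n → Bool,
          (∏ i, K (e s i) (s i) (o i)) * Real.log (g o) ≤
        α * n + β * expectedConst n e + Real.log ((∑ o, g o) / 2 ^ n) := by
  intro n
  induction n with
  | zero =>
    intro e _ g _
    simp [expectedConst]
  | succ n ih =>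
    intro e he g hg
    -- By causality the first input depends on the first state alone, so padding with `false` is
    -- immaterial.
    set t : Bool → Bool := fun b => e (Fin.cons b fun _ => false) 0 with ht
    have ht' : ∀ b (s : Fin n → Bool), e (Fin.cons b s) 0 = t b := by
      intro b s
      refine he 0 _ _ fun j hj => ?_
      have : j = 0 := le_antisymm hj (Fin.zero_le j)
      subst this
      simp
    set E : Bool → (Fin n → Bool) → Fin n → Bool := fun b s i => e (Fin.cons b s) i.succ with hE
    have hEc : ∀ b (i : Fin n) (s s' : Fin n → Bool), (∀ j, j ≤ i → s j = s' j) →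
        E b s i = E b s' i := by
      intro b i s s' h
      refine he i.succ _ _ fun j hj => ?_
      refine Fin.cases (fun _ => by simp) (fun j hj => ?_) j hj
      simpa using h j (Fin.succ_le_succ_iff.1 hj)
    -- Averaging `g` over the later outputs leaves a function of the first one: the induction
    -- hypothesis bounds the tail by `log G`, and `step` then applies to `G`.
    set G : Bool → ℝ := fun b => (∑ o : Fin n → Bool, g (Fin.cons b o)) / 2 ^ n with hG
    have hGpos : ∀ b, 0 < G b := fun b =>
      div_pos (Finset.sum_pos (fun o _ => hg _) Finset.univ_nonempty) (by positivity)
    have hlhs : ∑ s : Fin (n + 1) → Bool, (1 / 2) ^ (n + 1) * ∑ o : Fin (n + 1) → Bool,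
          (∏ i, K (e s i) (s i) (o i)) * Real.log (g o) =
        ∑ b, 1 / 2 * ∑ c, K (t b) b c * ∑ s : Fin n → Bool, (1 / 2) ^ n *
          ∑ o : Fin n → Bool, (∏ i, K (E b s i) (s i) (o i)) * Real.log (g (Fin.cons c o)) := by
      rw [sum_boolVec_succ]
      refine Finset.sum_congr rfl fun b _ => ?_
      simp only [sum_boolVec_succ, Fin.prod_univ_succ, Fin.cons_zero, Fin.cons_succ, ht',
        Finset.mul_sum]
      rw [Finset.sum_comm]
      refine Finset.sum_congr rfl fun c _ => Finset.sum_congr rfl fun s _ =>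
        Finset.sum_congr rfl fun o _ => ?_
      rw [pow_succ, hE]
      ring
    have hsum : (∑ o, g o) / 2 ^ (n + 1) = (∑ c, G c) / 2 := by
      rw [sum_boolVec_succ, hG, ← Finset.sum_div, pow_succ, div_div]
    rw [hlhs, hsum]
    calc _ ≤ ∑ b, 1 / 2 * ∑ c, K (t b) b c *
          (α * n + β * expectedConst n (E b) + Real.log (G c)) := by
          refine Finset.sum_le_sum fun b _ => mul_le_mul_of_nonneg_left
            (Finset.sum_le_sum fun c _ => mul_le_mul_of_nonneg_left ?_ (hK _ _ _)) (by norm_num)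
          exact ih (E b) (hEc b) (fun o => g (Fin.cons c o)) fun o => hg _
      _ = α * n + β * ∑ b, 1 / 2 * expectedConst n (E b) +
          ∑ s, 1 / 2 * ∑ o, K (t s) s o * Real.log (G o) := by
          simp only [mul_add, Finset.sum_add_distrib, ← Finset.sum_mul, hK1, Fintype.sum_bool]
          ring
      _ ≤ _ := by
          have := step t G hGpos
          rw [expectedConst]
          push_cast
          linarith

/-- Fano's inequality in the form needed for a causal encoder. -/
theorem fano_bound (K : Bool → Bool → Bool → ℝ) (hK : ∀ x s o, 0 ≤ K x s o)
    (hK1 : ∀ x s, ∑ o, K x s o = 1) (α β : ℝ)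
    (step : ∀ (t : Bool → Bool) (g : Bool → ℝ), (∀ o, 0 < g o) →
      ∑ s, 1 / 2 * ∑ o, K (t s) s o * Real.log (g o) ≤
        α + β * constIndicator t + Real.log ((∑ o, g o) / 2))
    {n M : ℕ} (e : Fin M → (Fin n → Bool) → Fin n → Bool)
    (he : ∀ m (i : Fin n) (s s' : Fin n → Bool), (∀ j, j ≤ i → s j = s' j) →
      e m s i = e m s' i)
    (dec : (Fin n → Bool) → Fin M) :
    (∑ m, ∑ s : Fin n → Bool, (1 / 2) ^ n * ∑ o : Fin n → Bool,
        (∏ i, K (e m s i) (s i) (o i)) * (if dec o = m then 1 else 0)) * Real.log M ≤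
      ∑ m, (α * n + β * expectedConst n (e m) + Real.log 2) := by
  -- With this test function the expectation of `log g` is `log M` times the probability of correct
  -- decoding.
  set g : Fin M → (Fin n → Bool) → ℝ := fun m o => if dec o = m then M else 1 with hg
  have hgpos : ∀ m o, 0 < g m o := by
    intro m o
    have : 0 < M := m.pos
    simp only [hg]
    split_ifs <;> positivity
  have hlog : ∀ m o, Real.log (g m o) = (if dec o = m then 1 else 0) * Real.log M := by
    intro m o
    simp only [hg]
    split_ifs <;> simp
  have h1 : ∀ m, (∑ s : Fin n → Bool, (1 / 2) ^ n * ∑ o : Fin n → Bool,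
        (∏ i, K (e m s i) (s i) (o i)) * (if dec o = m then 1 else 0)) * Real.log M ≤
      α * n + β * expectedConst n (e m) + (Real.log 2 + ((∑ o, g m o) / 2 ^ n / 2 - 1)) := by
    intro m
    have hpos : 0 < (∑ o, g m o) / 2 ^ n :=
      div_pos (Finset.sum_pos (fun o _ => hgpos m o) Finset.univ_nonempty) (by positivity)
    have h := expected_log_le K hK hK1 α β step n (e m) (he m) (g m) (hgpos m)
    -- The logarithm is replaced by its tangent at 2 because the uniform mean of `g m`, averaged
    -- over `m`, is at most 2; after summation only `log 2` per message remains.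
    have h2 : Real.log ((∑ o, g m o) / 2 ^ n) ≤
        Real.log 2 + ((∑ o, g m o) / 2 ^ n / 2 - 1) := by
      have := Real.log_le_sub_one_of_pos (half_pos hpos)
      rw [Real.log_div hpos.ne' (by norm_num)] at this
      linarith
    simp only [hlog] at h
    simp only [Finset.sum_mul, Finset.mul_sum, mul_assoc] at h ⊢
    linarith
  have h3 : ∑ m, ∑ o, g m o ≤ 2 ^ n * (2 * M) := by
    rw [Finset.sum_comm]
    calc _ ≤ ∑ _o : Fin n → Bool, (2 * M : ℝ) := by
          refine Finset.sum_le_sum fun o _ => ?_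
          calc ∑ m, g m o ≤ ∑ m, ((if dec o = m then (M : ℝ) else 0) + 1) := by
                refine Finset.sum_le_sum fun m _ => ?_
                simp only [hg]
                split_ifs <;> simp
            _ = 2 * M := by
                rw [Finset.sum_add_distrib]
                simp
                ring
      _ = _ := by simp
  rw [Finset.sum_mul]
  refine (Finset.sum_le_sum fun m _ => h1 m).trans ?_
  simp only [Finset.sum_add_distrib, Finset.sum_sub_distrib, ← Finset.sum_div]
  have h4 : (∑ m, ∑ o, g m o) / 2 ^ n / 2 ≤ M := by
    rw [div_div, div_le_iff₀ (by positivity)]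
    linarith
  simp
  linarith

/-! ### Single-use bounds for the two outputs -/

/-- This is `log x ≤ x - 1` at `x = b / (p s)`, multiplied by `p` so that `p = 0` is covered. -/
theorem mul_log_sub_mul_log_le {p b s : ℝ} (hp : 0 ≤ p) (hb : 0 < b) (hs : 0 < s) :
    p * Real.log b - p * Real.log p ≤ p * Real.log s + b / s - p := by
  rcases hp.eq_or_lt with rfl | hp
  · simp [(div_pos hb hs).le]
  · have h := mul_le_mul_of_nonneg_left
      (Real.log_le_sub_one_of_pos (div_pos hb (mul_pos hp hs))) hp.le
    rw [Real.log_div hb.ne' (mul_pos hp hs).ne', Real.log_mul hp.ne' hs.ne'] at h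
    have : p * (b / (p * s) - 1) = b / s - p := by field_simp
    linarith

/-- The Gibbs inequality on two points. -/
theorem weighted_log_add_binEntropy_le {p a b : ℝ} (hp : p ∈ Set.Icc (0 : ℝ) 1) (ha : 0 < a)
    (hb : 0 < b) :
    (1 - p) * Real.log a + p * Real.log b + Real.binEntropy p ≤ Real.log (a + b) := by
  have h1 := mul_log_sub_mul_log_le hp.1 hb (add_pos ha hb)
  have h2 := mul_log_sub_mul_log_le (sub_nonneg.2 hp.2) ha (add_pos ha hb)
  have h3 : a / (a + b) + b / (a + b) = 1 := by
    rw [← add_div, div_self (add_pos ha hb).ne']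
  simp only [Real.binEntropy, Real.log_inv]
  linarith

theorem half_log_add_half_log_le {a b : ℝ} (ha : 0 < a) (hb : 0 < b) :
    1 / 2 * Real.log a + 1 / 2 * Real.log b + Real.log 2 ≤ Real.log (a + b) := by
  have h := weighted_log_add_binEntropy_le (p := 2⁻¹) ⟨by norm_num, by norm_num⟩ ha hb
  rw [Real.binEntropy_two_inv] at h
  norm_num at h ⊢
  linarith

theorem log_le_log_add_right {a b : ℝ} (ha : 0 < a) (hb : 0 < b) :
    Real.log a ≤ Real.log (a + b) :=
  Real.log_le_log ha (by linarith)

/-- The law of the deterministic output `x ⊕ s`. -/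
noncomputable def xorKernel (x s o : Bool) : ℝ := if o = xor x s then 1 else 0

/-- A constant `t` makes the output uniform; otherwise `t s ⊕ s` does not depend on `s`, and the
divergence from uniform is `log 2`. -/
theorem xorKernel_step (t : Bool → Bool) (g : Bool → ℝ) (hg : ∀ o, 0 < g o) :
    ∑ s, 1 / 2 * ∑ o, xorKernel (t s) s o * Real.log (g o) ≤
      Real.log 2 + -Real.log 2 * constIndicator t + Real.log ((∑ o, g o) / 2) := by
  have h1 := half_log_add_half_log_le (hg true) (hg false)
  have h2 := log_le_log_add_right (hg true) (hg false)
  have h3 := log_le_log_add_right (hg false) (hg true)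
  rw [add_comm (g false)] at h3
  simp only [Fintype.sum_bool]
  rw [Real.log_div (add_pos (hg _) (hg _)).ne' (by norm_num)]
  unfold constIndicator xorKernel
  cases h : t false <;> cases h' : t true <;> simp <;> linarith

/-- The law of the output of the binary symmetric channel. -/
noncomputable def bscKernel (p : ℝ) (x _s o : Bool) : ℝ := if o = x then 1 - p else p

/-- The roles are reversed: a nonconstant `t` makes the input, hence the output, uniform, while a
constant one leaves only the entropy of the noise. -/
theorem bscKernel_step {p : ℝ} (hp : p ∈ Set.Icc (0 : ℝ) 1) (t : Bool → Bool) (g : Bool → ℝ)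
    (hg : ∀ o, 0 < g o) :
    ∑ s, 1 / 2 * ∑ o, bscKernel p (t s) s o * Real.log (g o) ≤
      0 + (Real.log 2 - Real.binEntropy p) * constIndicator t + Real.log ((∑ o, g o) / 2) := by
  have h1 := half_log_add_half_log_le (hg true) (hg false)
  have h2 := weighted_log_add_binEntropy_le hp (hg true) (hg false)
  have h3 := weighted_log_add_binEntropy_le hp (hg false) (hg true)
  rw [add_comm (g false)] at h3
  simp only [Fintype.sum_bool]
  rw [Real.log_div (add_pos (hg _) (hg _)).ne' (by norm_num)]
  unfold constIndicator bscKernel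
  cases h : t false <;> cases h' : t true <;> simp <;> linarith

theorem bscKernel_nonneg {p : ℝ} (hp : p ∈ Set.Icc (0 : ℝ) 1) (x s o : Bool) :
    0 ≤ bscKernel p x s o := by
  unfold bscKernel
  split_ifs
  · exact sub_nonneg.2 hp.2
  · exact hp.1

theorem bscKernel_sum (p : ℝ) (x s : Bool) : ∑ o, bscKernel p x s o = 1 := by
  cases x <;> simp [bscKernel]

/-! ### Converse for a single code -/

theorem sum_prod_xorKernel {n : ℕ} (x s : Fin n → Bool) (F : (Fin n → Bool) → ℝ) :
    ∑ o : Fin n → Bool, (∏ i, xorKernel (x i) (s i) (o i)) * F o =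
      F fun i => xor (x i) (s i) := by
  rw [Finset.sum_eq_single fun i => xor (x i) (s i)]
  · simp [xorKernel]
  · intro o _ ho
    obtain ⟨i, hi⟩ := Function.ne_iff.1 ho
    rw [Finset.prod_eq_zero (Finset.mem_univ i), zero_mul]
    simp [xorKernel, hi]
  · simp

theorem binaryChannel_half_errorProb {p : ℝ} (hσ : (1 / 2 : ℝ) ∈ Set.Icc (0 : ℝ) 1)
    (hp : p ∈ Set.Icc (0 : ℝ) 1) {n My Mz : ℕ} (c : CausalCode Bool Bool Bool Bool n My Mz) :
    (binaryChannel (1 / 2) p hσ hp).errorProb c =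
      (∑ my : Fin My, ∑ mz : Fin Mz, ∑ s : Fin n → Bool, (1 / 2) ^ n * ∑ z : Fin n → Bool,
        (∏ i, bscKernel p (c.encode my mz s i) (s i) (z i)) *
          (if c.decodeY (fun i => xor (c.encode my mz s i) (s i)) = my ∧ c.decodeZ z = mz
            then 0 else 1)) / ((My : ℝ) * (Mz : ℝ)) := by
  have h : ∀ s, (binaryChannel (1 / 2) p hσ hp).stateLaw s = 1 / 2 := by
    intro s
    cases s <;> norm_num [binaryChannel]
  unfold SemidetChannel.errorProb
  simp only [h, Finset.prod_const, Finset.card_univ, Fintype.card_fin, Finset.mul_sum, mul_assoc]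
  rfl

/-- The two rate bounds for a single code, with a common time-sharing parameter. -/
theorem exists_rate_bounds {p : ℝ} (hσ : (1 / 2 : ℝ) ∈ Set.Icc (0 : ℝ) 1)
    (hp : p ∈ Set.Icc (0 : ℝ) 1) {n My Mz : ℕ} (hMy : 0 < My) (hMz : 0 < Mz)
    (c : CausalCode Bool Bool Bool Bool n My Mz) :
    ∃ D : ℝ, 0 ≤ D ∧
      (1 - (binaryChannel (1 / 2) p hσ hp).errorProb c) * Real.log My ≤
        Real.log 2 * n - Real.log 2 * D + Real.log 2 ∧
      (1 - (binaryChannel (1 / 2) p hσ hp).errorProb c) * Real.log Mz ≤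
        (Real.log 2 - Real.binEntropy p) * D + Real.log 2 := by
  set err : ℝ := (binaryChannel (1 / 2) p hσ hp).errorProb c with herr
  have hMy' : (0 : ℝ) < My := by exact_mod_cast hMy
  have hMz' : (0 : ℝ) < Mz := by exact_mod_cast hMz
  set T : ℝ := ∑ my : Fin My, ∑ mz : Fin Mz, expectedConst n (c.encode my mz) with hT
  have hT0 : 0 ≤ T := Finset.sum_nonneg fun my _ => Finset.sum_nonneg fun mz _ =>
    expectedConst_nonneg n _
  have hone : ∀ my mz, ∑ s : Fin n → Bool, (1 / 2) ^ n * ∑ z : Fin n → Bool,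
      (∏ i, bscKernel p (c.encode my mz s i) (s i) (z i)) = 1 := by
    intro my mz
    simp only [sum_prod_eq_one _ fun i => bscKernel_sum p _ _]
    simp
  have herr' : My * Mz * (1 - err) = ∑ my : Fin My, ∑ mz : Fin Mz, ∑ s : Fin n → Bool,
      (1 / 2) ^ n * ∑ z : Fin n → Bool,
        (∏ i, bscKernel p (c.encode my mz s i) (s i) (z i)) *
          (if c.decodeY (fun i => xor (c.encode my mz s i) (s i)) = my ∧ c.decodeZ z = mz
            then 1 else 0) := by
    rw [mul_sub, herr, binaryChannel_half_errorProb, mul_div_cancel₀ _ (by positivity), mul_one]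
    rw [sub_eq_iff_eq_add]
    simp only [← Finset.sum_add_distrib, ← mul_add]
    have : ∀ P : Prop, [Decidable P] → ((if P then (1 : ℝ) else 0) + if P then 0 else 1) = 1 := by
      intro P _
      split_ifs <;> simp
    simp only [this, mul_one, hone]
    simp
  have hW : ∀ my mz s (z : Fin n → Bool), 0 ≤ ∏ i, bscKernel p (c.encode my mz s i) (s i) (z i) :=
    fun my mz s z => Finset.prod_nonneg fun i _ => bscKernel_nonneg hp _ _ _
  have hY : My * Mz * (1 - err) ≤ ∑ mz : Fin Mz, ∑ my : Fin My, ∑ s : Fin n → Bool,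
      (1 / 2) ^ n * ∑ o : Fin n → Bool,
        (∏ i, xorKernel (c.encode my mz s i) (s i) (o i)) *
          (if c.decodeY o = my then 1 else 0) := by
    rw [herr', Finset.sum_comm]
    refine Finset.sum_le_sum fun mz _ => Finset.sum_le_sum fun my _ =>
      Finset.sum_le_sum fun s _ => mul_le_mul_of_nonneg_left ?_ (by positivity)
    -- `Y` is determined by input and state, so its kernel sum collapses to one term, and the noise
    -- of `Z` is summed out.
    rw [sum_prod_xorKernel]
    split_ifs with h
    · refine le_trans (Finset.sum_le_sum fun z _ => ?_)
        (sum_prod_eq_one _ fun i => bscKernel_sum p (c.encode my mz s i) (s i)).le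
      refine mul_le_of_le_one_right (hW _ _ _ _) ?_
      split_ifs <;> norm_num
    · simp [h]
  have hZ : My * Mz * (1 - err) ≤ ∑ my : Fin My, ∑ mz : Fin Mz, ∑ s : Fin n → Bool,
      (1 / 2) ^ n * ∑ o : Fin n → Bool,
        (∏ i, bscKernel p (c.encode my mz s i) (s i) (o i)) *
          (if c.decodeZ o = mz then 1 else 0) := by
    rw [herr']
    refine Finset.sum_le_sum fun my _ => Finset.sum_le_sum fun mz _ =>
      Finset.sum_le_sum fun s _ => mul_le_mul_of_nonneg_left ?_ (by positivity)
    refine Finset.sum_le_sum fun z _ => mul_le_mul_of_nonneg_left ?_ (hW _ _ _ _)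
    split_ifs with h h'
    exacts [le_rfl, absurd h.2 h', zero_le_one, le_rfl]
  have hY2 := (mul_le_mul_of_nonneg_right hY (Real.log_natCast_nonneg My)).trans
    ((Finset.sum_mul _ _ _).le.trans (Finset.sum_le_sum fun mz _ => fano_bound xorKernel
      (fun x s o => by unfold xorKernel; split_ifs <;> norm_num)
      (fun x s => by simp [xorKernel]) _ _ xorKernel_step (fun my => c.encode my mz)
      (fun my => c.causal my mz) c.decodeY))
  have hZ2 := (mul_le_mul_of_nonneg_right hZ (Real.log_natCast_nonneg Mz)).trans
    ((Finset.sum_mul _ _ _).le.trans (Finset.sum_le_sum fun my _ => fano_bound (bscKernel p) (bscKernel_nonneg hp)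
      (bscKernel_sum p) _ _ (bscKernel_step hp) (fun mz => c.encode my mz)
      (fun mz => c.causal my mz) c.decodeZ))
  rw [Finset.sum_comm] at hY2
  simp only [Finset.sum_add_distrib, ← Finset.mul_sum, ← hT, Finset.sum_const, Finset.card_univ,
    Fintype.card_fin, nsmul_eq_mul] at hY2 hZ2
  have hP : (0 : ℝ) < My * Mz := by positivity
  refine ⟨T / (My * Mz), by positivity, ?_, ?_⟩
  · refine le_of_mul_le_mul_left ?_ hP
    have : My * Mz * (Real.log 2 * n - Real.log 2 * (T / (My * Mz)) + Real.log 2) =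
      My * Mz * (Real.log 2 * n) - Real.log 2 * T + My * Mz * Real.log 2 := by
      field_simp
    rw [this]
    linarith
  · refine le_of_mul_le_mul_left ?_ hP
    have : My * Mz * ((Real.log 2 - Real.binEntropy p) * (T / (My * Mz)) + Real.log 2) =
      (Real.log 2 - Real.binEntropy p) * T + My * Mz * Real.log 2 := by
      field_simp
    rw [this]
    linarith

/-! ### Coding for the binary symmetric channel -/

/-- First and second moments of a sum of IID centred variables. -/
theorem iid_moments (q f : Bool → ℝ) (hq : ∑ b, q b = 1) (hf : ∑ b, q b * f b = 0) (n : ℕ) :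
    ∑ v : Fin n → Bool, (∏ i, q (v i)) * ∑ i, f (v i) = 0 ∧
      ∑ v : Fin n → Bool, (∏ i, q (v i)) * (∑ i, f (v i)) ^ 2 = n * ∑ b, q b * f b ^ 2 := by
  induction n with
  | zero => simp
  | succ n ih =>
    obtain ⟨h1, h2⟩ := ih
    have h0 := sum_prod_eq_one (fun _ : Fin n => q) fun _ => hq
    constructor
    · rw [sum_boolVec_succ]
      simp only [Fin.prod_univ_succ, Fin.sum_univ_succ, Fin.cons_zero, Fin.cons_succ]
      have : ∀ b, ∑ w : Fin n → Bool, (q b * ∏ i, q (w i)) * (f b + ∑ i, f (w i)) =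
          q b * f b * ∑ w : Fin n → Bool, ∏ i, q (w i) +
            q b * ∑ w : Fin n → Bool, (∏ i, q (w i)) * ∑ i, f (w i) := by
        intro b
        rw [Finset.mul_sum, Finset.mul_sum, ← Finset.sum_add_distrib]
        exact Finset.sum_congr rfl fun w _ => by ring
      simp only [this, h0, h1, mul_one, mul_zero, add_zero, hf]
    · rw [sum_boolVec_succ]
      simp only [Fin.prod_univ_succ, Fin.sum_univ_succ, Fin.cons_zero, Fin.cons_succ]
      have : ∀ b, ∑ w : Fin n → Bool, (q b * ∏ i, q (w i)) * (f b + ∑ i, f (w i)) ^ 2 =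
          q b * f b ^ 2 * (∑ w : Fin n → Bool, ∏ i, q (w i)) +
            2 * q b * f b * (∑ w : Fin n → Bool, (∏ i, q (w i)) * ∑ i, f (w i)) +
            q b * ∑ w : Fin n → Bool, (∏ i, q (w i)) * (∑ i, f (w i)) ^ 2 := by
        intro b
        rw [Finset.mul_sum, Finset.mul_sum, Finset.mul_sum, ← Finset.sum_add_distrib,
          ← Finset.sum_add_distrib]
        exact Finset.sum_congr rfl fun w _ => by ring
      simp only [this, h0, h1, h2, mul_one, mul_zero, add_zero, Finset.sum_add_distrib,
        ← Finset.sum_mul, hq]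
      push_cast
      ring

/-- The vectors whose probability under the product law is at least `exp (-n a)`. -/
noncomputable def typicalSet (q : Bool → ℝ) (n : ℕ) (a : ℝ) : Finset (Fin n → Bool) :=
  Finset.univ.filter fun v => Real.exp (-(n * a)) ≤ ∏ i, q (v i)

theorem card_typicalSet_le (q : Bool → ℝ) (hq0 : ∀ b, 0 ≤ q b) (hq : ∑ b, q b = 1) (n : ℕ)
    (a : ℝ) : ((typicalSet q n a).card : ℝ) ≤ Real.exp (n * a) := by
  have h : ((typicalSet q n a).card : ℝ) * Real.exp (-(n * a)) ≤ 1 := by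
    rw [← nsmul_eq_mul, ← Finset.sum_const, ← sum_prod_eq_one (fun _ : Fin n => q) fun _ => hq]
    refine (Finset.sum_le_sum fun v hv => ?_).trans (Finset.sum_le_sum_of_subset_of_nonneg
      (Finset.subset_univ (typicalSet q n a)) fun v _ _ => Finset.prod_nonneg fun i _ => hq0 _)
    exact (Finset.mem_filter.1 hv).2
  rwa [Real.exp_neg, ← div_eq_mul_inv, div_le_one (Real.exp_pos _)] at h

/-- Chebyshev's inequality for the self-information. Vectors of probability zero, where the
logarithm is meaningless, have no weight. -/
theorem atypical_mul_sq_le (q : Bool → ℝ) (hq0 : ∀ b, 0 ≤ q b) (hq : ∑ b, q b = 1) (n : ℕ)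
    {h δ : ℝ} (hδ : 0 ≤ δ) (hh : h = ∑ b, q b * -Real.log (q b)) :
    (1 - ∑ v ∈ typicalSet q n (h + δ), ∏ i, q (v i)) * (n * δ) ^ 2 ≤
      n * ∑ b, q b * (-Real.log (q b) - h) ^ 2 := by
  have hf : ∑ b, q b * (-Real.log (q b) - h) = 0 := by
    simp only [mul_sub, Finset.sum_sub_distrib, ← Finset.sum_mul, hq, ← hh]
    ring
  rw [← (iid_moments q (fun b => -Real.log (q b) - h) hq hf n).2]
  nth_rewrite 1 [← sum_prod_eq_one (fun _ : Fin n => q) fun _ => hq]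
  rw [typicalSet, Finset.sum_filter, ← Finset.sum_sub_distrib, Finset.sum_mul]
  refine Finset.sum_le_sum fun v _ => ?_
  have hP : 0 ≤ ∏ i, q (v i) := Finset.prod_nonneg fun i _ => hq0 _
  split_ifs with hv
  · rw [sub_self, zero_mul]
    positivity
  · rw [sub_zero]
    rcases hP.eq_or_lt with h0 | h0
    · simp [← h0]
    · refine mul_le_mul_of_nonneg_left (pow_le_pow_left₀ (by positivity) ?_ 2) hP
      have hlt := Real.log_lt_log h0 (not_le.1 hv)
      rw [Real.log_exp, Real.log_prod fun i _ => (Finset.prod_ne_zero_iff.1 h0.ne') i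
        (Finset.mem_univ i)] at hlt
      simp only [Finset.sum_sub_distrib, Finset.sum_neg_distrib, Finset.sum_const,
        Finset.card_univ, Fintype.card_fin, nsmul_eq_mul]
      linarith

theorem sum_xorVec {n : ℕ} (u : Fin n → Bool) (F : (Fin n → Bool) → ℝ) :
    ∑ z : Fin n → Bool, F (fun i => xor (u i) (z i)) = ∑ z, F z := by
  have hinv : Function.Involutive fun (z : Fin n → Bool) i => xor (u i) (z i) := by
    intro z
    funext i
    simp
  exact Equiv.sum_comp hinv.toPerm F

/-- Feinstein's maximal code construction for a channel with additive binary noise. A value of the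
decoder that is not below `k` stands for a decoding failure. -/
theorem feinstein (q : Bool → ℝ) (hq0 : ∀ b, 0 ≤ q b) (hq : ∑ b, q b = 1) {n : ℕ}
    (T : Finset (Fin n → Bool)) {η : ℝ} (hT : 1 - η ≤ ∑ v ∈ T, ∏ i, q (v i)) (k : ℕ)
    (hk : (k : ℝ) * T.card < η * 2 ^ n) :
    ∃ (u : ℕ → Fin n → Bool) (d : (Fin n → Bool) → ℕ),
      (∀ j < k, 1 - 2 * η ≤ ∑ z : Fin n → Bool,
        (∏ i, q (xor (u j i) (z i))) * (if d z = j then 1 else 0)) ∧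
      (Finset.univ.filter fun z => d z < k).card ≤ k * T.card := by
  induction k with
  | zero => exact ⟨fun _ _ => false, fun _ => 0, by simp, by simp⟩
  | succ k ih =>
    have hk' : (k : ℝ) * T.card < η * 2 ^ n := by
      refine lt_of_le_of_lt (mul_le_mul_of_nonneg_right ?_ (Nat.cast_nonneg _)) hk
      push_cast
      linarith
    obtain ⟨u, d, h1, h2⟩ := ih hk'
    -- Otherwise, summing over all `v`, the region already claimed would have at least `η 2 ^ n`
    -- points, more than `k * T.card` allows.
    obtain ⟨v, hv⟩ : ∃ v : Fin n → Bool, ∑ z : Fin n → Bool,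
        (∏ i, q (xor (v i) (z i))) * (if d z < k then 1 else 0) < η := by
      by_contra! hcon
      have hle : ∑ _v : Fin n → Bool, η ≤ _ := Finset.sum_le_sum fun v _ => hcon v
      rw [Finset.sum_comm] at hle
      simp only [← Finset.sum_mul] at hle
      have : ∀ z : Fin n → Bool, ∑ v : Fin n → Bool, ∏ i, q (xor (v i) (z i)) = 1 := by
        intro z
        refine sum_prod_eq_one (fun i b => q (xor b (z i))) fun i => ?_
        simp only [Fintype.sum_bool] at hq ⊢
        cases z i <;> simp <;> linarith
      simp only [this, one_mul, Finset.sum_boole, Finset.sum_const, Finset.card_univ,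
        Fintype.card_fun, Fintype.card_bool, Fintype.card_fin, nsmul_eq_mul] at hle
      have h2' : (((Finset.univ.filter fun z => d z < k).card : ℕ) : ℝ) ≤ k * T.card := by
        exact_mod_cast h2
      push_cast at hle
      linarith
    -- The new word claims the unclaimed part of its translate of `T`, losing at most `η` to
    -- atypical noise and `η` to earlier claims. The value `k + 1` still means failure for `k + 1`
    -- words.
    refine ⟨Function.update u k v, fun z => if d z < k then d z else
      if (fun i => xor (v i) (z i)) ∈ T then k else k + 1, ?_, ?_⟩
    · intro j hj
      rcases (Nat.lt_succ_iff.1 hj).lt_or_eq with hjk | rfl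
      · rw [Function.update_of_ne hjk.ne]
        refine (h1 j hjk).trans (Finset.sum_le_sum fun z _ => mul_le_mul_of_nonneg_left ?_
          (Finset.prod_nonneg fun i _ => hq0 _))
        dsimp only
        split_ifs <;> first | omega | norm_num
      · rw [Function.update_self]
        have hTv : ∑ z : Fin n → Bool, (∏ i, q (xor (v i) (z i))) *
            (if (fun i => xor (v i) (z i)) ∈ T then 1 else 0) = ∑ e ∈ T, ∏ i, q (e i) := by
          rw [sum_xorVec v fun e => (∏ i, q (e i)) * if e ∈ T then 1 else 0]
          simp
        have hsub : ∑ z : Fin n → Bool, ((∏ i, q (xor (v i) (z i))) *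
            (if (fun i => xor (v i) (z i)) ∈ T then 1 else 0) -
            (∏ i, q (xor (v i) (z i))) * (if d z < j then 1 else 0)) ≤
            ∑ z : Fin n → Bool, (∏ i, q (xor (v i) (z i))) *
              (if (if d z < j then d z else
                if (fun i => xor (v i) (z i)) ∈ T then j else j + 1) = j then 1 else 0) := by
          refine Finset.sum_le_sum fun z _ => ?_
          rw [← mul_sub]
          refine mul_le_mul_of_nonneg_left ?_ (Finset.prod_nonneg fun i _ => hq0 _)
          split_ifs <;> first | omega | norm_num
        rw [Finset.sum_sub_distrib, hTv] at hsub
        linarith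
    · have hcard : (Finset.univ.filter fun z : Fin n → Bool =>
          (fun i => xor (v i) (z i)) ∈ T).card ≤ T.card := by
        refine Finset.card_le_card_of_injOn (fun z i => xor (v i) (z i))
          (fun z hz => (Finset.mem_filter.1 hz).2) fun z _ z' _ hzz => ?_
        funext i
        simpa using congrFun hzz i
      calc _ ≤ ((Finset.univ.filter fun z => d z < k) ∪ Finset.univ.filter
            fun z : Fin n → Bool => (fun i => xor (v i) (z i)) ∈ T).card := by
            refine Finset.card_le_card fun z hz => ?_
            simp only [Finset.mem_filter, Finset.mem_univ, true_and, Finset.mem_union] at hz ⊢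
            split_ifs at hz <;> first | tauto | omega
        _ ≤ k * T.card + T.card := (Finset.card_union_le _ _).trans (add_le_add h2 hcard)
        _ = (k + 1) * T.card := by ring

/-- Achievability part of the coding theorem for the binary symmetric channel. -/
theorem bsc_coding {p : ℝ} (hp : p ∈ Set.Icc (0 : ℝ) 1) {R : ℝ}
    (hR : R < Real.log 2 - Real.binEntropy p) {ε : ℝ} (hε : 0 < ε) :
    ∃ N : ℕ, ∀ n : ℕ, N ≤ n → ∀ M : ℕ, 0 < M → (M : ℝ) ≤ Real.exp (n * R) →
      ∃ (u : Fin M → Fin n → Bool) (dec : (Fin n → Bool) → Fin M), ∀ m,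
        ∑ z : Fin n → Bool, (∏ i, bscKernel p (u m i) false (z i)) *
          (if dec z = m then 0 else 1) ≤ ε := by
  set q : Bool → ℝ := fun b => if b then p else 1 - p with hqdef
  have hq0 : ∀ b, 0 ≤ q b := by
    intro b
    cases b
    · simpa [hqdef] using hp.2
    · simpa [hqdef] using hp.1
  have hq : ∑ b, q b = 1 := by simp [hqdef]
  set h := Real.binEntropy p with hh
  have hh' : h = ∑ b, q b * -Real.log (q b) := by
    simp [hqdef, hh, Real.binEntropy, Real.log_inv]
    ring
  -- Half the gap to capacity pays for the typical set; the other half leaves the factor `exp (-n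
  -- δ)`.
  set δ : ℝ := (Real.log 2 - h - R) / 2 with hδdef
  have hδ : 0 < δ := by
    rw [hδdef]
    linarith
  set V : ℝ := ∑ b, q b * (-Real.log (q b) - h) ^ 2 with hV
  have hlim1 : Filter.Tendsto (fun n : ℕ => ε / 2 * δ ^ 2 * (n : ℝ)) Filter.atTop
      Filter.atTop := tendsto_natCast_atTop_atTop.const_mul_atTop (by positivity)
  have hlim2 : Filter.Tendsto (fun n : ℕ => (n : ℝ) * δ + Real.log (ε / 2)) Filter.atTop
      Filter.atTop := Filter.tendsto_atTop_add_const_right _ _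
        (tendsto_natCast_atTop_atTop.atTop_mul_const hδ)
  obtain ⟨N, hN⟩ := Filter.eventually_atTop.1 (((hlim1.eventually_ge_atTop V).and
    (hlim2.eventually_gt_atTop 0)).and (Filter.eventually_ge_atTop 1))
  refine ⟨N, fun n hn M hM hMR => ?_⟩
  obtain ⟨⟨hn1, hn2⟩, hn0⟩ := hN n hn
  have hnpos : (0 : ℝ) < n := by exact_mod_cast hn0
  have hT : 1 - ε / 2 ≤ ∑ v ∈ typicalSet q n (h + δ), ∏ i, q (v i) := by
    have hat := atypical_mul_sq_le q hq0 hq n hδ.le hh'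
    have hle : n * V ≤ ε / 2 * (n * δ) ^ 2 := by nlinarith
    have := le_of_mul_le_mul_right (hat.trans hle) (by positivity)
    linarith
  have hcard : (M : ℝ) * (typicalSet q n (h + δ)).card < ε / 2 * 2 ^ n := by
    calc _ ≤ Real.exp (n * R) * Real.exp (n * (h + δ)) :=
          mul_le_mul hMR (card_typicalSet_le q hq0 hq n _) (by positivity) (by positivity)
      _ = Real.exp (n * Real.log 2 - n * δ) := by
          rw [← Real.exp_add]
          congr 1
          rw [hδdef]
          ring
      _ < Real.exp (Real.log (ε / 2) + n * Real.log 2) := Real.exp_lt_exp.2 (by linarith)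
      _ = _ := by
          rw [Real.exp_add, Real.exp_log (by positivity), Real.exp_nat_mul,
            Real.exp_log (by norm_num)]
  obtain ⟨u, d, hud, -⟩ := feinstein q hq0 hq _ hT M hcard
  refine ⟨fun m => u m, fun z => if hz : d z < M then ⟨d z, hz⟩ else ⟨0, hM⟩, fun m => ?_⟩
  have hbsc : ∀ x z, bscKernel p x false z = q (xor x z) := by
    intro x z
    cases x <;> cases z <;> simp [bscKernel, hqdef]
  have hm := hud m m.2
  have hsum := sum_prod_eq_one (fun i => bscKernel p (u m i) false)
    fun i => bscKernel_sum p _ _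
  simp only [hbsc] at hsum ⊢
  have : ∑ z : Fin n → Bool, (∏ i, q (xor (u m i) (z i))) *
        (if (if hz : d z < M then (⟨d z, hz⟩ : Fin M) else ⟨0, hM⟩) = m then 0 else 1) ≤
      ∑ z : Fin n → Bool, ((∏ i, q (xor (u m i) (z i))) -
        (∏ i, q (xor (u m i) (z i))) * (if d z = m then 1 else 0)) := by
    refine Finset.sum_le_sum fun z _ => ?_
    have hP : 0 ≤ ∏ i, q (xor (u m i) (z i)) := Finset.prod_nonneg fun i _ => hq0 _
    by_cases hd : d z = m
    · simp [hd]
    · rw [if_neg hd, mul_zero, sub_zero]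
      refine mul_le_of_le_one_right hP ?_
      split_ifs <;> norm_num
  rw [Finset.sum_sub_distrib, hsum] at this
  linarith

/-! ### The time-sharing code -/

/-- The code that sends the first message noiselessly by adding the state during the first `k`
channel uses, and the second message with a given code during the last `m` ones. -/
theorem exists_timeSharing_code {p : ℝ} (hσ : (1 / 2 : ℝ) ∈ Set.Icc (0 : ℝ) 1)
    (hp : p ∈ Set.Icc (0 : ℝ) 1) {k m My Mz : ℕ} (hMy : 0 < My) (hMz : 0 < Mz)
    (hk : My ≤ 2 ^ k) {ε : ℝ} (u : Fin Mz → Fin m → Bool) (dec : (Fin m → Bool) → Fin Mz)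
    (hu : ∀ mz, ∑ z : Fin m → Bool, (∏ i, bscKernel p (u mz i) false (z i)) *
      (if dec z = mz then 0 else 1) ≤ ε) :
    ∃ c : CausalCode Bool Bool Bool Bool (k + m) My Mz,
      (binaryChannel (1 / 2) p hσ hp).errorProb c ≤ ε := by
  obtain ⟨φ⟩ : Nonempty (Fin My ↪ (Fin k → Bool)) :=
    Function.Embedding.nonempty_of_card_le (by simpa using hk)
  have : Nonempty (Fin My) := ⟨⟨0, hMy⟩⟩
  have hMy' : (0 : ℝ) < My := by exact_mod_cast hMy
  have hMz' : (0 : ℝ) < Mz := by exact_mod_cast hMz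
  let c : CausalCode Bool Bool Bool Bool (k + m) My Mz :=
    { encode := fun my mz s => Fin.append (fun i => xor (φ my i) (s (Fin.castAdd m i))) (u mz)
      causal := by
        intro my mz i s s' hs
        refine Fin.addCases (fun i hs => ?_) (fun i _ => ?_) i hs
        · simp [hs _ le_rfl]
        · simp
      decodeY := fun y => Function.invFun φ fun i => y (Fin.castAdd m i)
      decodeZ := fun z => dec fun i => z (Fin.natAdd k i) }
  refine ⟨c, ?_⟩
  rw [binaryChannel_half_errorProb, div_le_iff₀ (by positivity)]
  have hterm : ∀ my mz, ∑ s : Fin (k + m) → Bool, (1 / 2) ^ (k + m) *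
      ∑ z : Fin (k + m) → Bool, (∏ i, bscKernel p (c.encode my mz s i) (s i) (z i)) *
          (if c.decodeY (fun i => xor (c.encode my mz s i) (s i)) = my ∧ c.decodeZ z = mz
            then 0 else 1) ≤ ε := by
    intro my mz
    have hY : ∀ s, c.decodeY (fun i => xor (c.encode my mz s i) (s i)) = my := by
      intro s
      simp only [c, Fin.append_left, Bool.xor_assoc, Bool.xor_self, Bool.xor_false]
      exact Function.leftInverse_invFun φ.injective my
    have hz : ∀ s, ∑ z : Fin (k + m) → Bool,
        (∏ i, bscKernel p (c.encode my mz s i) (s i) (z i)) *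
          (if c.decodeZ z = mz then 0 else 1) ≤ ε := by
      intro s
      rw [← (Fin.appendEquiv k m).sum_comp, Fintype.sum_prod_type]
      simp only [Fin.appendEquiv, Equiv.coe_fn_mk, Fin.prod_univ_add, c, Fin.append_left,
        Fin.append_right, mul_assoc, ← Finset.mul_sum]
      -- The second decoder ignores the first `k` outputs, so their law sums to one.
      rw [← Finset.sum_mul, sum_prod_eq_one _ fun i => bscKernel_sum p _ _, one_mul]
      exact hu mz
    simp only [hY, true_and]
    refine (Finset.sum_le_sum fun s _ => mul_le_mul_of_nonneg_left (hz s)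
      (by positivity)).trans_eq ?_
    simp
  refine (Finset.sum_le_sum fun my _ => Finset.sum_le_sum fun mz _ => hterm my mz).trans_eq ?_
  simp
  ring

/-! ### Rates, limits and the capacity region -/

theorem one_sub_binEntropyBits (p : ℝ) :
    1 - binEntropyBits p = (Real.log 2 - Real.binEntropy p) / Real.log 2 := by
  rw [binEntropyBits, sub_div, div_self (Real.log_pos one_lt_two).ne']

theorem one_sub_binEntropyBits_nonneg (p : ℝ) : 0 ≤ 1 - binEntropyBits p := by
  rw [one_sub_binEntropyBits]
  exact div_nonneg (sub_nonneg.2 Real.binEntropy_le_log_two) (Real.log_pos one_lt_two).le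

theorem one_sub_binEntropyBits_pos {p : ℝ} (h : p ≠ 1 / 2) : 0 < 1 - binEntropyBits p := by
  rw [one_sub_binEntropyBits]
  refine div_pos (sub_pos.2 (Real.binEntropy_lt_log_two.2 ?_)) (Real.log_pos one_lt_two)
  rwa [← one_div]

theorem one_le_floor_two_rpow {x : ℝ} (hx : 0 ≤ x) : 1 ≤ ⌊(2 : ℝ) ^ x⌋₊ :=
  Nat.le_floor (by exact_mod_cast Real.one_le_rpow one_le_two hx)

/-- Rounding down a number that is at least 1 costs at most a factor 2, that is, one bit. -/
theorem sub_one_mul_log_two_le_log_floor {x : ℝ} (hx : 0 ≤ x) :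
    (x - 1) * Real.log 2 ≤ Real.log ⌊(2 : ℝ) ^ x⌋₊ := by
  have h1 : (1 : ℝ) ≤ ⌊(2 : ℝ) ^ x⌋₊ := by exact_mod_cast one_le_floor_two_rpow hx
  have h2 := Nat.lt_floor_add_one ((2 : ℝ) ^ x)
  have h3 : Real.log ((2 : ℝ) ^ x) ≤ Real.log (2 * ⌊(2 : ℝ) ^ x⌋₊) :=
    Real.log_le_log (by positivity) (by linarith)
  rw [Real.log_rpow two_pos, Real.log_mul two_ne_zero (by positivity)] at h3
  linarith

theorem le_of_forall_natCast_mul_le {a b : ℝ} (ha : 0 ≤ a)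
    (h : ∀ ε : ℝ, 0 < ε → ε < 1 → ∃ (N : ℕ) (B : ℝ), ∀ n : ℕ, N ≤ n →
      (n : ℝ) * ((1 - ε) * a - b) ≤ B) : a ≤ b := by
  by_contra! hab
  have hpos : 0 < (a - b) / (2 * (a + 1)) := div_pos (sub_pos.2 hab) (by linarith)
  -- This `ε` keeps `(1 - ε) a - b` positive, so its multiples by `n` are unbounded; `a + 1` avoids
  -- division by zero.
  obtain ⟨N, B, hN⟩ := h (min (1 / 2) ((a - b) / (2 * (a + 1)))) (lt_min (by norm_num) hpos)
    ((min_le_left _ _).trans_lt (by norm_num))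
  set ε := min (1 / 2) ((a - b) / (2 * (a + 1))) with hε
  have h1 : ε * (2 * (a + 1)) ≤ a - b := (le_div_iff₀ (by linarith)).1 (min_le_right _ _)
  have hε0 : 0 < ε := lt_min (by norm_num) hpos
  have h2 : 0 < (1 - ε) * a - b := by nlinarith
  obtain ⟨n, hn1, hn2⟩ := ((Filter.eventually_ge_atTop N).and
    ((tendsto_natCast_atTop_atTop.atTop_mul_const h2).eventually_gt_atTop B)).exists
  exact (hN n hn1).not_gt hn2

/-- The converse. -/
theorem rate_bounds_of_causallyAchievable {p : ℝ} (hσ : (1 / 2 : ℝ) ∈ Set.Icc (0 : ℝ) 1)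
    (hp : p ∈ Set.Icc (0 : ℝ) 1) {R : ℝ × ℝ}
    (hR : (binaryChannel (1 / 2) p hσ hp).CausallyAchievable R) :
    R.1 ≤ 1 ∧ (1 - binEntropyBits p) * R.1 + R.2 ≤ 1 - binEntropyBits p := by
  obtain ⟨hR1, hR2, hR⟩ := hR
  have hl : 0 < Real.log 2 := Real.log_pos one_lt_two
  set c := 1 - binEntropyBits p with hc
  have hc0 : 0 ≤ c := one_sub_binEntropyBits_nonneg p
  have hcl : Real.log 2 - Real.binEntropy p = c * Real.log 2 := by
    rw [hc, one_sub_binEntropyBits, div_mul_cancel₀ _ hl.ne']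
  have key : ∀ ε : ℝ, 0 < ε → ε < 1 → ∃ N : ℕ, ∀ n : ℕ, N ≤ n → ∃ D : ℝ, 0 ≤ D ∧
      (1 - ε) * (n * R.1 - 1) ≤ n - D + 1 ∧ (1 - ε) * (n * R.2 - 1) ≤ c * D + 1 := by
    intro ε hε hε1
    obtain ⟨N, hN⟩ := hR ε hε
    refine ⟨N, fun n hn => ?_⟩
    obtain ⟨code, herr⟩ := hN n hn
    have h1 : 0 ≤ n * R.1 := by positivity
    have h2 : 0 ≤ n * R.2 := by positivity
    obtain ⟨D, hD, hY, hZ⟩ := exists_rate_bounds hσ hp (one_le_floor_two_rpow h1)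
      (one_le_floor_two_rpow h2) code
    rw [hcl] at hZ
    have aux : ∀ x : ℝ, 0 ≤ x → (1 - ε) * (x - 1) * Real.log 2 ≤
        (1 - (binaryChannel (1 / 2) p hσ hp).errorProb code) *
          Real.log ⌊(2 : ℝ) ^ x⌋₊ := by
      intro x hx
      rw [mul_assoc]
      refine (mul_le_mul_of_nonneg_left (sub_one_mul_log_two_le_log_floor hx)
        (by linarith)).trans (mul_le_mul_of_nonneg_right (by linarith)
          (Real.log_natCast_nonneg _))
    refine ⟨D, hD, le_of_mul_le_mul_right ?_ hl, le_of_mul_le_mul_right ?_ hl⟩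
    · linarith [aux _ h1]
    · linarith [aux _ h2]
  constructor
  · refine le_of_forall_natCast_mul_le hR1 fun ε hε hε1 => ?_
    obtain ⟨N, hN⟩ := key ε hε hε1
    refine ⟨N, 2, fun n hn => ?_⟩
    obtain ⟨D, hD, hY, -⟩ := hN n hn
    linarith
  · refine le_of_forall_natCast_mul_le (by positivity) fun ε hε hε1 => ?_
    obtain ⟨N, hN⟩ := key ε hε hε1
    refine ⟨N, 2 * (c + 1), fun n hn => ?_⟩
    obtain ⟨D, hD, hY, hZ⟩ := hN n hn
    -- Weighting the first bound by `c` cancels `D` in the sum.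
    have h1 := mul_le_mul_of_nonneg_left hY hc0
    have h2 : 0 ≤ ε * (c + 1) := by positivity
    linarith

/-- The direct part, away from the boundary of the region. -/
theorem causallyAchievable_of_lt {p : ℝ} (hσ : (1 / 2 : ℝ) ∈ Set.Icc (0 : ℝ) 1)
    (hp : p ∈ Set.Icc (0 : ℝ) 1) {R : ℝ × ℝ} (h1 : 0 ≤ R.1) (h2 : 0 ≤ R.2) (h3 : R.1 ≤ 1)
    (h4 : R.2 = 0 ∨ R.2 < (1 - R.1) * (1 - binEntropyBits p)) :
    (binaryChannel (1 / 2) p hσ hp).CausallyAchievable R := by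
  refine ⟨h1, h2, fun ε hε => ?_⟩
  have hl : 0 < Real.log 2 := Real.log_pos one_lt_two
  suffices H : ∃ N : ℕ, ∀ n : ℕ, N ≤ n → ∀ m : ℕ, (n : ℝ) * (1 - R.1) - 1 ≤ m →
      ∃ (u : Fin ⌊(2 : ℝ) ^ ((n : ℝ) * R.2)⌋₊ → Fin m → Bool)
        (dec : (Fin m → Bool) → Fin ⌊(2 : ℝ) ^ ((n : ℝ) * R.2)⌋₊), ∀ mz,
          ∑ z : Fin m → Bool, (∏ i, bscKernel p (u mz i) false (z i)) *
            (if dec z = mz then 0 else 1) ≤ ε by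
    obtain ⟨N, hN⟩ := H
    refine ⟨N, fun n hn => ?_⟩
    have hkn : ⌈(n : ℝ) * R.1⌉₊ ≤ n :=
      Nat.ceil_le.2 (mul_le_of_le_one_right (Nat.cast_nonneg n) h3)
    have hceil := Nat.ceil_lt_add_one (a := (n : ℝ) * R.1) (by positivity)
    have hMy : ⌊(2 : ℝ) ^ ((n : ℝ) * R.1)⌋₊ ≤ 2 ^ ⌈(n : ℝ) * R.1⌉₊ := by
      refine Nat.floor_le_of_le ?_
      push_cast
      rw [← Real.rpow_natCast]
      exact Real.rpow_le_rpow_of_exponent_le one_le_two (Nat.le_ceil _)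
    have hMy0 := one_le_floor_two_rpow (x := (n : ℝ) * R.1) (by positivity)
    have hMz0 := one_le_floor_two_rpow (x := (n : ℝ) * R.2) (by positivity)
    have hm : ∀ m, ⌈(n : ℝ) * R.1⌉₊ + m = n → (n : ℝ) * (1 - R.1) - 1 ≤ m := by
      intro m hm
      have : (⌈(n : ℝ) * R.1⌉₊ : ℝ) + m = n := by exact_mod_cast hm
      linarith
    have hN' := hN n hn
    -- The message counts and `k` are decoupled from `n` so that `n` can be replaced by `k + m`.
    generalize ⌊(2 : ℝ) ^ ((n : ℝ) * R.1)⌋₊ = My at *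
    generalize ⌊(2 : ℝ) ^ ((n : ℝ) * R.2)⌋₊ = Mz at *
    generalize ⌈(n : ℝ) * R.1⌉₊ = k at *
    obtain ⟨m, rfl⟩ := Nat.exists_eq_add_of_le hkn
    obtain ⟨u, dec, hu⟩ := hN' m (hm m rfl)
    exact exists_timeSharing_code hσ hp hMy0 hMz0 hMy u dec hu
  rcases h4 with h4 | h4
  · refine ⟨0, fun n _ m _ => ?_⟩
    have hM : ⌊(2 : ℝ) ^ ((n : ℝ) * R.2)⌋₊ = 1 := by simp [h4]
    rw [hM]
    refine ⟨fun _ _ => false, fun _ => 0, fun mz => ?_⟩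
    simp [Subsingleton.elim mz 0, hε.le]
  · set c := 1 - binEntropyBits p with hc
    have hcl : Real.log 2 - Real.binEntropy p = c * Real.log 2 := by
      rw [hc, one_sub_binEntropyBits, div_mul_cancel₀ _ hl.ne']
    have hR1 : 0 < 1 - R.1 := by
      rcases h3.eq_or_lt with h | h
      · rw [h] at h4
        linarith
      · linarith
    -- A rate below capacity with slack over `R.2 / (1 - R.1)`, which absorbs the channel use lost
    -- to the ceiling.
    obtain ⟨ρ, hρ1, hρ2⟩ := exists_between ((div_lt_iff₀' hR1).2 h4)
    have hρ0 : 0 ≤ ρ := (div_nonneg h2 hR1.le).trans hρ1.le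
    have hρ3 : 0 < (1 - R.1) * ρ - R.2 := sub_pos.2 ((div_lt_iff₀' hR1).1 hρ1)
    obtain ⟨N₀, hN₀⟩ := bsc_coding hp (R := ρ * Real.log 2)
      (by rw [hcl]; exact mul_lt_mul_of_pos_right hρ2 hl) hε
    obtain ⟨N, hN⟩ := Filter.eventually_atTop.1
      (((tendsto_natCast_atTop_atTop (R := ℝ)).atTop_mul_const hρ3).eventually_ge_atTop ρ |>.and
      (((tendsto_natCast_atTop_atTop (R := ℝ)).atTop_mul_const hR1).eventually_ge_atTop (N₀ + 1)))
    refine ⟨N, fun n hn m hm => ?_⟩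
    obtain ⟨hn1, hn2⟩ := hN n hn
    have hmN : N₀ ≤ m := by
      have : (N₀ : ℝ) ≤ m := by linarith
      exact_mod_cast this
    refine hN₀ m hmN _ (one_le_floor_two_rpow (by positivity)) ?_
    refine (Nat.floor_le (by positivity)).trans ?_
    rw [Real.rpow_def_of_pos two_pos]
    refine Real.exp_le_exp.2 ?_
    have : (n : ℝ) * R.2 ≤ m * ρ := by
      have := mul_le_mul_of_nonneg_right hm hρ0
      linarith
    have := mul_le_mul_of_nonneg_right this hl.le
    linarith

/-- Linear inequalities make the region visibly closed; `R.1 ≤ 1` is kept because the last one does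
not imply it when `p = 1 / 2`. -/
theorem causalCapacityRegion_binaryChannel_half {p : ℝ} (hσ : (1 / 2 : ℝ) ∈ Set.Icc (0 : ℝ) 1)
    (hp : p ∈ Set.Icc (0 : ℝ) 1) :
    (binaryChannel (1 / 2) p hσ hp).causalCapacityRegion =
      {R : ℝ × ℝ | 0 ≤ R.1 ∧ 0 ≤ R.2 ∧ R.1 ≤ 1 ∧
        (1 - binEntropyBits p) * R.1 + R.2 ≤ 1 - binEntropyBits p} := by
  set c := 1 - binEntropyBits p with hc
  have hc0 : 0 ≤ c := one_sub_binEntropyBits_nonneg p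
  refine Set.Subset.antisymm ?_ ?_
  · refine closure_minimal (fun R hR => ?_) ?_
    · obtain ⟨h1, h2⟩ := rate_bounds_of_causallyAchievable hσ hp hR
      exact ⟨hR.1, hR.2.1, h1, h2⟩
    · simp only [Set.ofPred_and]
      exact (isClosed_le (by fun_prop) (by fun_prop)).inter
        ((isClosed_le (by fun_prop) (by fun_prop)).inter
          ((isClosed_le (by fun_prop) (by fun_prop)).inter
            (isClosed_le (by fun_prop) (by fun_prop))))
  · rintro R ⟨h1, h2, h3, h4⟩
    -- Shrinking by `θ < 1` makes the last inequality strict, or `R.2 = 0` if `c = 0`.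
    have hlim : Filter.Tendsto (fun θ : ℝ => θ • R) (nhdsWithin 1 (Set.Ioo 0 1)) (nhds R) := by
      have : Filter.Tendsto (fun θ : ℝ => θ • R) (nhds 1) (nhds ((1 : ℝ) • R)) :=
        (continuous_id.smul continuous_const).tendsto 1
      rw [one_smul] at this
      exact this.mono_left nhdsWithin_le_nhds
    have : (nhdsWithin (1 : ℝ) (Set.Ioo 0 1)).NeBot := by
      rw [← mem_closure_iff_nhdsWithin_neBot, closure_Ioo zero_ne_one]
      exact ⟨zero_le_one, le_rfl⟩
    refine mem_closure_of_tendsto hlim (Filter.mem_of_superset self_mem_nhdsWithin ?_)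
    rintro θ ⟨hθ0, hθ1⟩
    refine causallyAchievable_of_lt hσ hp (mul_nonneg hθ0.le h1) (mul_nonneg hθ0.le h2)
      (mul_le_one₀ hθ1.le h1 h3) ?_
    rcases hc0.eq_or_lt with hc' | hc'
    · left
      rw [← hc'] at h4
      have : R.2 = 0 := by linarith
      simp [this]
    · right
      rw [← hc]
      simp only [Prod.smul_fst, Prod.smul_snd, smul_eq_mul]
      have := mul_le_mul_of_nonneg_left h4 hθ0.le
      have := mul_pos (sub_pos.2 hθ1) hc'
      linarith

theorem mainTheorem4 (p : ℝ) (hp : p ∈ Set.Icc (0 : ℝ) 1) :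
    ((binaryChannel (1 / 2) p ⟨by norm_num, by norm_num⟩ hp).causalCapacityRegion =
        (⋃ l ∈ Set.Icc (0 : ℝ) 1,
          {R : ℝ × ℝ | 0 ≤ R.1 ∧ 0 ≤ R.2 ∧
            R.1 ≤ l ∧ R.2 ≤ (1 - l) * (1 - binEntropyBits p)})) ∧
      (p ≠ 1 / 2 →
        (binaryChannel (1 / 2) p ⟨by norm_num, by norm_num⟩ hp).causalCapacityRegion =
          {R : ℝ × ℝ | 0 ≤ R.1 ∧ 0 ≤ R.2 ∧ R.1 + R.2 / (1 - binEntropyBits p) ≤ 1}) := by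
  have key := causalCapacityRegion_binaryChannel_half (p := p) ⟨by norm_num, by norm_num⟩ hp
  refine ⟨key.trans ?_, fun hne => key.trans ?_⟩
  · have hc0 := one_sub_binEntropyBits_nonneg p
    ext R
    simp only [Set.mem_iUnion, Set.mem_ofPred_eq, exists_prop, Set.mem_Icc]
    constructor
    · rintro ⟨h1, h2, h3, h4⟩
      -- The best time-sharing parameter is `R.1` itself.
      exact ⟨R.1, ⟨h1, h3⟩, h1, h2, le_rfl, by linarith⟩
    · rintro ⟨l, ⟨-, hl1⟩, h1, h2, h3, h4⟩
      have := mul_le_mul_of_nonneg_left h3 hc0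
      exact ⟨h1, h2, h3.trans hl1, by linarith⟩
  · have hc := one_sub_binEntropyBits_pos hne
    ext R
    simp only [Set.mem_ofPred_eq]
    refine and_congr_right fun _ => and_congr_right fun h2 => ?_
    have hiff : R.1 + R.2 / (1 - binEntropyBits p) ≤ 1 ↔
        (1 - binEntropyBits p) * R.1 + R.2 ≤ 1 - binEntropyBits p := by
      rw [← mul_le_mul_iff_right₀ hc, mul_add, mul_div_cancel₀ _ hc.ne', mul_one]
    rw [hiff]
    refine ⟨fun h => h.2, fun h => ⟨?_, h⟩⟩
    exact le_of_mul_le_mul_left (by linarith) hc
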